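/- **Setting.** Let $G^{\mathbb C}\subset \mathrm{SL}(n,\mathbb C)$ be a complex semisimple Lie group (a closed subgroup whose Lie algebra $\mathfrak g^{\mathbb C}$ is a complex semisimple Lie algebra), and let $G\subset G^{\mathbb C}$ be a real form, i.e. a closed subgroup whose Lie algebra $\mathfrak g$ satisfies $\mathfrak g^{\mathbb C}=\mathfrak g\oplus i\mathfrak g$. Let $H\subset G$ be a maximal compact subgroup, $\mathfrak g=\mathfrak h\oplus\mathfrak m$ the Cartan decomposition, $\mathfrak h^{\mathbb C},\mathfrak m^{\mathbb C}\subset\mathfrak g^{\mathbb C}$ the complexifications, and $H^{\mathbb C}$ the complexification of $H$. Let $X$ be a compact connected Riemann surface with holomorphic cotangent bundle $K$ (no restriction on the genus is needed), and let $P\to X$ be a smooth principal $H^{\mathbb C}$-bundle. Write $P[V]$ for the bundle associated with an $\mathrm{Ad}(H^{\mathbb C})$-invariant space $V$, and $\Omega^{p,q}(P[V])$ for the smooth $P[V]$-valued forms of type $(p,q)$, with $\Omega^0=\Omega^{0,0}$. A *$G$-Higgs bundle* $(\bar\partial_P,\varphi)$ on $P$ consists of a Dolbeault operator $\bar\partial_P$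 on $P$ (the $(0,1)$-part of a connection; equivalently a holomorphic structure on $P$) and a section $\varphi\in\Omega^{1,0}(P[\mathfrak m^{\mathbb C}])$ with $\bar\partial_P\varphi=0$. Its associated $\mathrm{SL}(n,\mathbb C)$-Higgs bundle is $(E,\Phi)$, with $E=P[\mathbb C^n]$ and $\Phi$ the image of $\varphi$ in $H^0(\mathrm{End}(E)\otimes K)$. The $G$-Higgs bundle is *polystable* if $(E,\Phi)=\bigoplus_j(E_j,\Phi_j)$ is a holomorphic direct sum of nonzero Higgs bundles of degree $0$ which are stable, i.e. every holomorphic subbundle $F\subset E_j$ with $0<\operatorname{rk}F<\operatorname{rk}E_j$ and $\Phi(F)\subset F\otimes K$ has $\deg F<0$. It is *stable* if it is polystable and its automorphism group (the group of gauge transformations, i.e. smooth sections of the bundle of groups $P\times_{\mathrm{Ad}}H^{\mathbb C}$, that preserve $\bar\partial_P$ and $\varphi$) is finite. Put $$H^0(P[\mathfrak h^{\mathbb C}])=\ker\big(\bar\partial_P:\Omega^0(P[\mathfrak h^{\mathbb C}])\to\Omega^{0,1}(P[\mathfrak h^{\mathbb C}])\big),\qquad H^1(P[\mathfrak h^{\mathbb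 C}])=\Omega^{0,1}(P[\mathfrak h^{\mathbb C}])/\bar\partial_P\Omega^0(P[\mathfrak h^{\mathbb C}]),$$ $$H^0(P[\mathfrak m^{\mathbb C}]\otimes K)=\ker\big(\bar\partial_P:\Omega^{1,0}(P[\mathfrak m^{\mathbb C}])\to\Omega^{1,1}(P[\mathfrak m^{\mathbb C}])\big),\qquad H^1(P[\mathfrak m^{\mathbb C}]\otimes K)=\Omega^{1,1}(P[\mathfrak m^{\mathbb C}])/\bar\partial_P\Omega^{1,0}(P[\mathfrak m^{\mathbb C}]).$$ The tangent space at $[\bar\partial_P,\varphi]$ to the moduli space $\mathcal M(G)$ of $G$-Higgs bundles is the quotient of the space of solutions of the linearized equation by the tangent space to the gauge orbit, $$T_{[\bar\partial_P,\varphi]}\mathcal M(G)=\frac{\{(\alpha,\psi)\in\Omega^{0,1}(P[\mathfrak h^{\mathbb C}])\oplus\Omega^{1,0}(P[\mathfrak m^{\mathbb C}])\ |\ \bar\partial_P\psi+[\alpha,\varphi]=0\}}{\{(\bar\partial_Px,[\varphi,x])\ |\ x\in\Omega^0(P[\mathfrak h^{\mathbb C}])\}}.$$ **Proposition.** For a stable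 $G$-Higgs bundle $(\bar\partial_P,\varphi)$ there is an exact sequence of complex vector spaces $$0\to H^0(P[\mathfrak h^{\mathbb C}])\xrightarrow{\ \mathrm{ad}_\varphi\ }H^0(P[\mathfrak m^{\mathbb C}]\otimes K)\xrightarrow{\ i\ }T_{[\bar\partial_P,\varphi]}\mathcal M(G)\xrightarrow{\ \pi\ }H^1(P[\mathfrak h^{\mathbb C}])\xrightarrow{\ \mathrm{ad}_\varphi\ }H^1(P[\mathfrak m^{\mathbb C}]\otimes K),$$ where the maps $\mathrm{ad}_\varphi$ are induced by $x\mapsto[\varphi,x]$ and $\alpha\mapsto[\varphi,\alpha]=[\alpha,\varphi]$, the map $i$ by the inclusion $\psi\mapsto(0,\psi)$, and the map $\pi$ by the projection $(\alpha,\psi)\mapsto\alpha$. -/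

import Mathlib

open scoped Manifold ContDiff

namespace HiggsTangent

noncomputable section

universe u v

/-! ### Real forms of complex semisimple Lie groups -/

section Groups

attribute [local instance 100] LieRing.ofAssociativeRing

/-- Complex square matrices of size `n`. -/
abbrev Mat (n : ℕ) : Type := Matrix (Fin n) (Fin n) ℂ

/-- `Y` lies in the Lie algebra of the (closed) subgroup `K` of `SL(n, ℂ)`: the one-parameter group
`t ↦ exp (t Y)`, `t` real, stays in `K`. -/
def TangentToSubgroup {n : ℕ} (K : Subgroup (Matrix.SpecialLinearGroup (Fin n) ℂ)) (Y : Mat n) :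
    Prop :=
  ∀ t : ℝ, ∃ k ∈ K, (k : Mat n) = NormedSpace.exp (t • Y)

/-- A real form `G` of a complex semisimple Lie subgroup `GC` of `SL(n, ℂ)`, together with a maximal
compact subgroup `H` of `G` and the Cartan decomposition `𝔤 = 𝔥 ⊕ 𝔪`. -/
structure RealForm (n : ℕ) where
  /-- the complex semisimple group -/
  GC : Subgroup (Matrix.SpecialLinearGroup (Fin n) ℂ)
  isClosed_GC : IsClosed (GC : Set (Matrix.SpecialLinearGroup (Fin n) ℂ))
  /-- its Lie algebra; that it is a complex subspace says that `GC` is a complex Lie group -/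
  gC : LieSubalgebra ℂ (Mat n)
  mem_gC : ∀ Y : Mat n, Y ∈ gC ↔ TangentToSubgroup GC Y
  semisimple_gC : LieAlgebra.IsSemisimple ℂ gC
  /-- the real form -/
  G : Subgroup (Matrix.SpecialLinearGroup (Fin n) ℂ)
  isClosed_G : IsClosed (G : Set (Matrix.SpecialLinearGroup (Fin n) ℂ))
  G_le_GC : G ≤ GC
  /-- the Lie algebra of `G` -/
  g : LieSubalgebra ℝ (Mat n)
  mem_g : ∀ Y : Mat n, Y ∈ g ↔ TangentToSubgroup G Y
  /-- `𝔤ᶜ = 𝔤 + i 𝔤` -/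
  gC_eq : ∀ Y ∈ gC, ∃ Y₁ ∈ g, ∃ Y₂ ∈ g, Y = Y₁ + Complex.I • Y₂
  /-- `𝔤 ∩ i 𝔤 = 0` -/
  g_totallyReal : ∀ Y ∈ g, Complex.I • Y ∈ g → Y = 0
  /-- the maximal compact subgroup of `G` -/
  H : Subgroup (Matrix.SpecialLinearGroup (Fin n) ℂ)
  H_le_G : H ≤ G
  isCompact_H : IsCompact (H : Set (Matrix.SpecialLinearGroup (Fin n) ℂ))
  maximal_H : ∀ K : Subgroup (Matrix.SpecialLinearGroup (Fin n) ℂ), K ≤ G →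
    IsCompact (K : Set (Matrix.SpecialLinearGroup (Fin n) ℂ)) → H ≤ K → K = H
  /-- the Lie algebra of `H` -/
  h : LieSubalgebra ℝ (Mat n)
  mem_h : ∀ Y : Mat n, Y ∈ h ↔ TangentToSubgroup H Y
  /-- the other summand of the Cartan decomposition -/
  m : Submodule ℝ (Mat n)
  m_le_g : ∀ Y ∈ m, Y ∈ g
  g_eq : ∀ Y ∈ g, ∃ Y₁ ∈ h, ∃ Y₂ ∈ m, Y = Y₁ + Y₂
  bracket_h_m : ∀ Y ∈ h, ∀ Z ∈ m, Y * Z - Z * Y ∈ m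
  bracket_m_m : ∀ Y ∈ m, ∀ Z ∈ m, Y * Z - Z * Y ∈ h
  ad_H_m : ∀ k ∈ H, ∀ Z ∈ m, (k : Mat n) * Z * ((k⁻¹ : Matrix.SpecialLinearGroup (Fin n) ℂ) : Mat n) ∈ m
  killing_h : ∀ Y : g, (Y : Mat n) ∈ h → Y ≠ 0 → killingForm ℝ g Y Y < 0
  killing_m : ∀ Y : g, (Y : Mat n) ∈ m → Y ≠ 0 → 0 < killingForm ℝ g Y Y

namespace RealForm

variable {n : ℕ} (R : RealForm n)

/-- `𝔥ᶜ`, the complexification of `𝔥` inside `𝔤ᶜ`. -/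
def hC : Submodule ℂ (Mat n) := Submodule.span ℂ (R.h : Set (Mat n))

/-- `𝔪ᶜ`, the complexification of `𝔪` inside `𝔤ᶜ`. -/
def mC : Submodule ℂ (Mat n) := Submodule.span ℂ (R.m : Set (Mat n))

/-- `Hᶜ`, the complexification of the compact group `H`: as `H` is a compact group of matrices, it is
the complex group `H · exp (i 𝔥)`, which is generated by `H` and `exp 𝔥ᶜ`. -/
def HC : Subgroup (Matrix.SpecialLinearGroup (Fin n) ℂ) :=
  Subgroup.closure ((R.H : Set (Matrix.SpecialLinearGroup (Fin n) ℂ)) ∪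
    {k | ∃ Y ∈ R.hC, (k : Mat n) = NormedSpace.exp Y})

/-- A real bracket relation passes to complex spans. -/
lemma bracket_span {S T : Set (Mat n)} {W : Submodule ℂ (Mat n)}
    (hST : ∀ Y ∈ S, ∀ Z ∈ T, Y * Z - Z * Y ∈ W) :
    ∀ Y ∈ Submodule.span ℂ S, ∀ Z ∈ Submodule.span ℂ T, Y * Z - Z * Y ∈ W := by
  intro Y hY Z hZ
  induction hY using Submodule.span_induction with
  | mem Y hY =>
    induction hZ using Submodule.span_induction with
    | mem Z hZ => exact hST Y hY Z hZ
    | zero => simp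
    | add Z₁ Z₂ _ _ h₁ h₂ =>
      have : Y * (Z₁ + Z₂) - (Z₁ + Z₂) * Y = (Y * Z₁ - Z₁ * Y) + (Y * Z₂ - Z₂ * Y) := by
        rw [mul_add, add_mul]; abel
      rw [this]; exact W.add_mem h₁ h₂
    | smul c Z _ h₁ =>
      have : Y * (c • Z) - (c • Z) * Y = c • (Y * Z - Z * Y) := by
        rw [mul_smul_comm, smul_mul_assoc, smul_sub]
      rw [this]; exact W.smul_mem c h₁
  | zero => simp
  | add Y₁ Y₂ _ _ h₁ h₂ =>
    have : (Y₁ + Y₂) * Z - Z * (Y₁ + Y₂) = (Y₁ * Z - Z * Y₁) + (Y₂ * Z - Z * Y₂) := by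
      rw [mul_add, add_mul]; abel
    rw [this]; exact W.add_mem h₁ h₂
  | smul c Y _ h₁ =>
    have : (c • Y) * Z - Z * (c • Y) = c • (Y * Z - Z * Y) := by
      rw [mul_smul_comm, smul_mul_assoc, smul_sub]
    rw [this]; exact W.smul_mem c h₁

lemma bracket_hC_hC : ∀ Y ∈ R.hC, ∀ Z ∈ R.hC, Y * Z - Z * Y ∈ R.hC :=
  bracket_span fun _ hY _ hZ => Submodule.subset_span (R.h.lie_mem hY hZ)

lemma bracket_hC_mC : ∀ Y ∈ R.hC, ∀ Z ∈ R.mC, Y * Z - Z * Y ∈ R.mC :=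
  bracket_span fun Y hY Z hZ => Submodule.subset_span (R.bracket_h_m Y hY Z hZ)

lemma bracket_mC_hC (Y : Mat n) (hY : Y ∈ R.mC) (Z : Mat n) (hZ : Z ∈ R.hC) :
    Y * Z - Z * Y ∈ R.mC := by
  have := R.mC.neg_mem (R.bracket_hC_mC Z hZ Y hY)
  rwa [neg_sub] at this

end RealForm

end Groups

/-! ### The operator `∂/∂z̄` -/

/-- `∂f/∂z̄ = (∂f/∂x + i ∂f/∂y) / 2`. -/
def dbarAt (f : ℂ → ℂ) (z : ℂ) : ℂ :=
  (1 / 2) * (fderiv ℝ f z 1 + Complex.I * fderiv ℝ f z Complex.I)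

lemma dbarAt_congr {f g : ℂ → ℂ} {z : ℂ} (h : f =ᶠ[nhds z] g) : dbarAt f z = dbarAt g z := by
  unfold dbarAt
  rw [h.fderiv_eq]

lemma dbarAt_add {f g : ℂ → ℂ} {z : ℂ} (hf : DifferentiableAt ℝ f z)
    (hg : DifferentiableAt ℝ g z) :
    dbarAt (fun w => f w + g w) z = dbarAt f z + dbarAt g z := by
  unfold dbarAt
  rw [fderiv_fun_add hf hg]
  simp only [_root_.add_apply]
  ring

lemma dbarAt_mul {f g : ℂ → ℂ} {z : ℂ} (hf : DifferentiableAt ℝ f z)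
    (hg : DifferentiableAt ℝ g z) :
    dbarAt (fun w => f w * g w) z = dbarAt f z * g z + f z * dbarAt g z := by
  unfold dbarAt
  rw [fderiv_fun_mul hf hg]
  simp only [_root_.add_apply, _root_.smul_apply, smul_eq_mul]
  ring

lemma dbarAt_sum {ι : Type*} (s : Finset ι) {f : ι → ℂ → ℂ} {z : ℂ}
    (hf : ∀ i ∈ s, DifferentiableAt ℝ (f i) z) :
    dbarAt (fun w => ∑ i ∈ s, f i w) z = ∑ i ∈ s, dbarAt (f i) z := by
  unfold dbarAt
  rw [fderiv_fun_sum hf]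
  simp only [_root_.sum_apply]
  rw [← Finset.mul_sum, Finset.sum_add_distrib, Finset.mul_sum]

lemma dbarAt_holomorphic {f : ℂ → ℂ} {z : ℂ} (hf : DifferentiableAt ℂ f z) : dbarAt f z = 0 := by
  unfold dbarAt
  rw [hf.fderiv_restrictScalars ℝ]
  have : fderiv ℂ f z Complex.I = Complex.I * fderiv ℂ f z 1 := by
    conv_lhs => rw [← mul_one Complex.I, ← smul_eq_mul, map_smul, smul_eq_mul]
  simp only [ContinuousLinearMap.coe_restrictScalars', this]
  rw [← mul_assoc, Complex.I_mul_I]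
  ring

lemma dbarAt_const_mul (c : ℂ) {f : ℂ → ℂ} {z : ℂ} (hf : DifferentiableAt ℝ f z) :
    dbarAt (fun w => c * f w) z = c * dbarAt f z := by
  rw [dbarAt_mul (differentiableAt_const c) hf,
    dbarAt_holomorphic (differentiableAt_const (𝕜 := ℂ) c)]
  ring

/-- Chain rule for a holomorphic change of coordinate. -/
lemma dbarAt_comp {f k : ℂ → ℂ} {z : ℂ} (hf : DifferentiableAt ℝ f (k z))
    (hk : DifferentiableAt ℂ k z) :
    dbarAt (fun w => f (k w)) z = starRingEnd ℂ (deriv k z) * dbarAt f (k z) := by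
  unfold dbarAt
  have h1 : HasFDerivAt (fun w => f (k w))
      ((fderiv ℝ f (k z)).comp ((fderiv ℂ k z).restrictScalars ℝ)) z :=
    hf.hasFDerivAt.comp z (hk.hasFDerivAt.restrictScalars ℝ)
  rw [h1.fderiv]
  have hd : ∀ v : ℂ, fderiv ℂ k z v = v * deriv k z := by
    intro v
    conv_lhs => rw [← mul_one v, ← smul_eq_mul, map_smul, smul_eq_mul]
    rw [fderiv_apply_one_eq_deriv]
  have hl : ∀ v : ℂ, fderiv ℝ f (k z) v =
      v.re * fderiv ℝ f (k z) 1 + v.im * fderiv ℝ f (k z) Complex.I := by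
    intro v
    have : v = v.re • (1 : ℂ) + v.im • Complex.I := by
      simp [Complex.re_add_im]
    conv_lhs => rw [this, map_add, map_smul, map_smul]
    simp
  simp only [ContinuousLinearMap.comp_apply, ContinuousLinearMap.coe_restrictScalars', hd]
  rw [hl (1 * deriv k z), hl (Complex.I * deriv k z)]
  have hc : starRingEnd ℂ (deriv k z) = (deriv k z).re - (deriv k z).im * Complex.I := by
    apply Complex.ext <;> simp
  rw [hc]
  simp only [one_mul, Complex.mul_re, Complex.mul_im, Complex.I_re, Complex.I_im]
  push_cast
  ring_nf
  simp only [Complex.I_sq]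
  ring

/-! ### Principal bundles over a Riemann surface -/

variable {n : ℕ} {X : Type u} [TopologicalSpace X] [ChartedSpace ℂ X]

/-- A smooth principal `K`-bundle over the Riemann surface `X`, presented by smooth transition
functions `g i j : U i ∩ U j → K` over a cover of `X` by holomorphic coordinate charts
`z i : U i → ℂ`. Its total space is glued from the `U i × K` by `(x, k)_j ∼ (x, g i j x * k)_i`;
a bundle `P[V]` associated with a representation `ρ` is glued from the `U i × V` by
`(x, v)_j ∼ (x, ρ (g i j x) v)_i`. -/
structure PrincipalBundle (X : Type u) [TopologicalSpace X] [ChartedSpace ℂ X]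
    (K : Subgroup (Matrix.SpecialLinearGroup (Fin n) ℂ)) where
  /-- the index set of the cover -/
  ι : Type v
  /-- the coordinates `z i : U i → ℂ` -/
  z : ι → OpenPartialHomeomorph X ℂ
  z_mem : ∀ i, z i ∈ IsManifold.maximalAtlas 𝓘(ℂ, ℂ) ω X
  cover : ∀ x : X, ∃ i, x ∈ (z i).source
  /-- the transition functions (only their values on `U i ∩ U j` are used) -/
  g : ι → ι → X → Matrix.SpecialLinearGroup (Fin n) ℂ
  g_mem : ∀ i j x, x ∈ (z i).source → x ∈ (z j).source → g i j x ∈ K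
  g_smooth : ∀ i j a b, ContDiffOn ℝ ∞ (fun w => (g i j ((z i).symm w) : Mat n) a b)
    ((z i).target ∩ (z i).symm ⁻¹' (z j).source)
  g_mul : ∀ i j k x, x ∈ (z i).source → x ∈ (z j).source → x ∈ (z k).source →
    g i j x * g j k x = g i k x

namespace PrincipalBundle

variable {K : Subgroup (Matrix.SpecialLinearGroup (Fin n) ℂ)} (P : PrincipalBundle.{u, v} X K)

/-- The coordinate domain `U i`. -/
def U (i : P.ι) : Set X := (P.z i).source

/-- The coordinate change `dz j / dz i` at a point of `U i ∩ U j`. -/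
def jac (i j : P.ι) (x : X) : ℂ := deriv (fun w => P.z j ((P.z i).symm w)) (P.z i x)

/-- `f` is smooth on the part of `U i` that lies in `N`, in the coordinate `z i`. -/
def SmoothIn (i : P.ι) (N : Set X) (f : X → ℂ) : Prop :=
  ContDiffOn ℝ ∞ (fun w => f ((P.z i).symm w)) ((P.z i).target ∩ (P.z i).symm ⁻¹' N)

/-- `∂f/∂z̄ i` at a point of `U i`. -/
def dbarFun (i : P.ι) (f : X → ℂ) (x : X) : ℂ :=
  dbarAt (fun w => f ((P.z i).symm w)) (P.z i x)

/-- `∂f/∂z̄ i` for a matrix-valued function, entry by entry. -/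
def dbarMat (i : P.ι) (f : X → Mat n) (x : X) : Mat n :=
  Matrix.of fun a b => P.dbarFun i (fun y => f y a b) x

/-- `∂f/∂z̄ i` for a vector-valued function, entry by entry. -/
def dbarVec (i : P.ι) (f : X → Fin n → ℂ) (x : X) : Fin n → ℂ :=
  fun a => P.dbarFun i (fun y => f y a) x

/-- `Ω^{p,q}(P[V])`, for `p, q ≤ 1` and an `Ad`-invariant space `V` of matrices: smooth forms of type
`(p, q)` on `X` with values in the bundle associated with the action of `K` on `V` by conjugation.
Such a form is the family of its coefficients `s i : U i → V` with respect to `1`, `dz i`,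
`dz̄ i`, `dz̄ i ∧ dz i` respectively (extended by zero to `X`); on `U i ∩ U j` one has
`s i = (dz j / dz i)^p * conj (dz j / dz i)^q • Ad (g i j) (s j)`. -/
def Form (V : Submodule ℂ (Mat n)) (p q : ℕ) : Submodule ℂ (P.ι → X → Mat n) where
  carrier := {s |
    (∀ i x, s i x ∈ V) ∧
    (∀ i x, x ∉ P.U i → s i x = 0) ∧
    (∀ i a b, P.SmoothIn i (P.U i) (fun x => s i x a b)) ∧
    (∀ i j x, x ∈ P.U i → x ∈ P.U j →
      s i x * (P.g i j x : Mat n) =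
        (P.jac i j x ^ p * starRingEnd ℂ (P.jac i j x) ^ q) • ((P.g i j x : Mat n) * s j x))}
  add_mem' := by
    rintro s t ⟨h1, h2, h3, h4⟩ ⟨k1, k2, k3, k4⟩
    refine ⟨fun i x => V.add_mem (h1 i x) (k1 i x), fun i x hx => ?_, fun i a b => ?_,
      fun i j x hi hj => ?_⟩
    · simp [h2 i x hx, k2 i x hx]
    · exact (h3 i a b).add (k3 i a b)
    · simp only [Pi.add_apply, add_mul, mul_add, smul_add, h4 i j x hi hj, k4 i j x hi hj]
  zero_mem' := by
    refine ⟨fun i x => V.zero_mem, fun i x hx => rfl, fun i a b => contDiffOn_const,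
      fun i j x hi hj => ?_⟩
    simp
  smul_mem' := by
    rintro c s ⟨h1, h2, h3, h4⟩
    refine ⟨fun i x => V.smul_mem c (h1 i x), fun i x hx => ?_, fun i a b => ?_,
      fun i j x hi hj => ?_⟩
    · simp [h2 i x hx]
    · exact contDiffOn_const.mul (h3 i a b)
    · simp only [Pi.smul_apply, smul_mul_assoc, mul_smul_comm, h4 i j x hi hj]
      rw [smul_comm]

variable {P} {V W Z : Submodule ℂ (Mat n)}

lemma SmoothIn.differentiableAt {i : P.ι} {N : Set X} {f : X → ℂ} (hf : P.SmoothIn i N f)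
    (hN : IsOpen N) {x : X} (hx : x ∈ P.U i) (hxN : x ∈ N) :
    DifferentiableAt ℝ (fun w => f ((P.z i).symm w)) (P.z i x) := by
  have ho := (P.z i).isOpen_inter_preimage_symm hN
  have hmem : P.z i x ∈ (P.z i).target ∩ (P.z i).symm ⁻¹' N :=
    ⟨(P.z i).map_source hx, by simpa [(P.z i).left_inv hx] using hxN⟩
  exact ((hf.contDiffAt (ho.mem_nhds hmem)).differentiableAt (by simp))

lemma isOpen_U (i : P.ι) : IsOpen (P.U i) := (P.z i).open_source

lemma SmoothIn.mul {i : P.ι} {N : Set X} {f g : X → ℂ} (hf : P.SmoothIn i N f)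
    (hg : P.SmoothIn i N g) : P.SmoothIn i N (fun x => f x * g x) :=
  ContDiffOn.mul hf hg

lemma SmoothIn.sub {i : P.ι} {N : Set X} {f g : X → ℂ} (hf : P.SmoothIn i N f)
    (hg : P.SmoothIn i N g) : P.SmoothIn i N (fun x => f x - g x) :=
  ContDiffOn.sub hf hg

lemma SmoothIn.add {i : P.ι} {N : Set X} {f g : X → ℂ} (hf : P.SmoothIn i N f)
    (hg : P.SmoothIn i N g) : P.SmoothIn i N (fun x => f x + g x) :=
  ContDiffOn.add hf hg

lemma SmoothIn.sum {α : Type*} {S : Finset α} {i : P.ι} {N : Set X} {f : α → X → ℂ}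
    (hf : ∀ a ∈ S, P.SmoothIn i N (f a)) : P.SmoothIn i N (fun x => ∑ a ∈ S, f a x) :=
  ContDiffOn.sum hf

lemma SmoothIn.congr {i : P.ι} {N : Set X} {f g : X → ℂ} (hf : P.SmoothIn i N f)
    (h : ∀ x ∈ P.U i, x ∈ N → g x = f x) : P.SmoothIn i N g :=
  ContDiffOn.congr hf fun _ hw => h _ ((P.z i).map_target hw.1) hw.2

lemma SmoothIn.mono {i : P.ι} {N N' : Set X} {f : X → ℂ} (hf : P.SmoothIn i N f)
    (h : N' ⊆ N) : P.SmoothIn i N' f :=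
  ContDiffOn.mono hf fun _ hw => ⟨hw.1, h hw.2⟩

lemma SmoothIn.commutator {i : P.ι} {N : Set X} {s t : X → Mat n}
    (hs : ∀ a b, P.SmoothIn i N (fun x => s x a b))
    (ht : ∀ a b, P.SmoothIn i N (fun x => t x a b)) (a b : Fin n) :
    P.SmoothIn i N (fun x => (s x * t x - t x * s x) a b) := by
  simp only [Matrix.sub_apply, Matrix.mul_apply]
  exact (SmoothIn.sum fun c _ => (hs a c).mul (ht c b)).sub
    (SmoothIn.sum fun c _ => (ht a c).mul (hs c b))

lemma SmoothIn.dbarFun {i : P.ι} {f : X → ℂ} (hf : P.SmoothIn i (P.U i) f) :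
    P.SmoothIn i (P.U i) (P.dbarFun i f) := by
  have ho := (P.z i).isOpen_inter_preimage_symm (isOpen_U i)
  have hd : ContDiffOn ℝ ∞ (fderiv ℝ (fun w => f ((P.z i).symm w)))
      ((P.z i).target ∩ (P.z i).symm ⁻¹' (P.U i)) :=
    ContDiffOn.fderiv_of_isOpen hf ho (by simp)
  have : ContDiffOn ℝ ∞ (dbarAt (fun w => f ((P.z i).symm w)))
      ((P.z i).target ∩ (P.z i).symm ⁻¹' (P.U i)) := by
    unfold dbarAt
    exact contDiffOn_const.mul ((hd.clm_apply contDiffOn_const).add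
      (contDiffOn_const.mul (hd.clm_apply contDiffOn_const)))
  refine ContDiffOn.congr this fun w hw => ?_
  simp only [PrincipalBundle.dbarFun]
  rw [(P.z i).right_inv hw.1]

lemma holomorphic_change (P : PrincipalBundle.{u, v} X K) (i j : P.ι) {x : X} (hi : x ∈ P.U i)
    (hj : x ∈ P.U j) :
    ∀ᶠ w in nhds (P.z i x), DifferentiableAt ℂ (fun w => P.z j ((P.z i).symm w)) w := by
  have hc := IsManifold.compatible_of_mem_maximalAtlas (P.z_mem i) (P.z_mem j)
  have h1 := (contMDiffOn_of_mem_contDiffGroupoid hc).contDiffOn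
  have hmem : P.z i x ∈ ((P.z i).symm ≫ₕ P.z j).source := by
    rw [OpenPartialHomeomorph.trans_source]
    refine ⟨(P.z i).map_source hi, ?_⟩
    show (P.z i).symm (P.z i x) ∈ (P.z j).source
    rw [(P.z i).left_inv hi]; exact hj
  have ho := ((P.z i).symm ≫ₕ P.z j).open_source
  filter_upwards [ho.mem_nhds hmem] with w hw
  exact (h1.contDiffAt (ho.mem_nhds hw)).differentiableAt (by simp)

lemma eventually_mem (P : PrincipalBundle.{u, v} X K) (i : P.ι) {x : X} (hi : x ∈ P.U i)
    {N : Set X} (hN : IsOpen N) (hx : x ∈ N) :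
    ∀ᶠ w in nhds (P.z i x), w ∈ (P.z i).target ∧ (P.z i).symm w ∈ N := by
  have ho := (P.z i).isOpen_inter_preimage_symm hN
  exact ho.mem_nhds ⟨(P.z i).map_source hi, by simpa [(P.z i).left_inv hi] using hx⟩

/-- `∂/∂z̄ i = conj (dz j / dz i) ∂/∂z̄ j`. -/
lemma dbarFun_change (P : PrincipalBundle.{u, v} X K) (i j : P.ι) {x : X} (hi : x ∈ P.U i)
    (hj : x ∈ P.U j) {f : X → ℂ}
    (hf : DifferentiableAt ℝ (fun w => f ((P.z j).symm w)) (P.z j x)) :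
    P.dbarFun i f x = starRingEnd ℂ (P.jac i j x) * P.dbarFun j f x := by
  have hk := (P.holomorphic_change i j hi hj).self_of_nhds
  have hx : (P.z i).symm (P.z i x) = x := (P.z i).left_inv hi
  have hf' : DifferentiableAt ℝ (fun w => f ((P.z j).symm w))
      ((fun w => P.z j ((P.z i).symm w)) (P.z i x)) := by
    simpa only [hx] using hf
  have h1 := dbarAt_comp hf' hk
  simp only [hx] at h1
  unfold dbarFun jac
  rw [← h1]
  refine dbarAt_congr ?_
  filter_upwards [P.eventually_mem i hi (isOpen_U j) hj] with w hw
  rw [(P.z j).left_inv hw.2]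

lemma dbarFun_congr (P : PrincipalBundle.{u, v} X K) (i : P.ι) {x : X} (hi : x ∈ P.U i)
    {f g : X → ℂ} {N : Set X} (hN : IsOpen N) (hx : x ∈ N) (h : ∀ y ∈ P.U i, y ∈ N → f y = g y) :
    P.dbarFun i f x = P.dbarFun i g x := by
  refine dbarAt_congr ?_
  filter_upwards [P.eventually_mem i hi hN hx] with w hw
  exact h _ ((P.z i).map_target hw.1) hw.2

lemma dbarMat_mul (P : PrincipalBundle.{u, v} X K) (i : P.ι) {x : X} (hi : x ∈ P.U i)
    {s t : X → Mat n}
    (hs : ∀ a b, DifferentiableAt ℝ (fun w => s ((P.z i).symm w) a b) (P.z i x))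
    (ht : ∀ a b, DifferentiableAt ℝ (fun w => t ((P.z i).symm w) a b) (P.z i x)) :
    P.dbarMat i (fun y => s y * t y) x = P.dbarMat i s x * t x + s x * P.dbarMat i t x := by
  ext a b
  have hx : (P.z i).symm (P.z i x) = x := (P.z i).left_inv hi
  simp only [dbarMat, dbarFun, Matrix.of_apply, Matrix.mul_apply, Matrix.add_apply]
  rw [dbarAt_sum _ fun c _ => (hs a c).fun_mul (ht c b), ← Finset.sum_add_distrib]
  refine Finset.sum_congr rfl fun c _ => ?_
  rw [dbarAt_mul (hs a c) (ht c b), hx]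

lemma dbarMat_sub (P : PrincipalBundle.{u, v} X K) (i : P.ι) {x : X}
    {s t : X → Mat n}
    (hs : ∀ a b, DifferentiableAt ℝ (fun w => s ((P.z i).symm w) a b) (P.z i x))
    (ht : ∀ a b, DifferentiableAt ℝ (fun w => t ((P.z i).symm w) a b) (P.z i x)) :
    P.dbarMat i (fun y => s y - t y) x = P.dbarMat i s x - P.dbarMat i t x := by
  ext a b
  simp only [dbarMat, dbarFun, Matrix.of_apply, Matrix.sub_apply]
  have := dbarAt_add (hs a b) ((ht a b).const_mul (-1))
  rw [dbarAt_const_mul _ (ht a b)] at this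
  simp only [sub_eq_add_neg]
  rw [← neg_one_mul, ← this]
  simp

/-- The (pointwise) commutator of forms. In the cases used below, `(0,0) × (1,0)`, `(1,0) × (0,0)`
and `(0,1) × (1,0)`, it is the bracket `[s ∧ t]`, by the choice of the frame `dz̄ ∧ dz`. -/
def bracket (hVW : ∀ Y ∈ V, ∀ Y' ∈ W, Y * Y' - Y' * Y ∈ Z) {p q p' q' p'' q'' : ℕ}
    (hp : p'' = p + p') (hq : q'' = q + q') :
    P.Form V p q →ₗ[ℂ] P.Form W p' q' →ₗ[ℂ] P.Form Z p'' q'' :=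
  LinearMap.mk₂ ℂ
    (fun s t => ⟨fun i x => s.1 i x * t.1 i x - t.1 i x * s.1 i x, by
      subst hp hq
      obtain ⟨s, h1, h2, h3, h4⟩ := s
      obtain ⟨t, k1, k2, k3, k4⟩ := t
      refine ⟨fun i x => hVW _ (h1 i x) _ (k1 i x), fun i x hx => ?_, fun i a b => ?_,
        fun i j x hi hj => ?_⟩
      · simp [h2 i x hx]
      · exact SmoothIn.commutator (h3 i) (k3 i) a b
      · have e1 := h4 i j x hi hj
        have e2 := k4 i j x hi hj
        simp only [sub_mul, mul_sub, smul_sub]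
        rw [mul_assoc, e2, mul_assoc (t i x), e1, mul_smul_comm, mul_smul_comm, ← mul_assoc,
          ← mul_assoc, e1, e2, smul_mul_assoc, smul_mul_assoc, smul_smul, smul_smul,
          mul_assoc (P.g i j x : Mat n) (s j x), mul_assoc (P.g i j x : Mat n) (t j x)]
        congr 1 <;> · congr 1; ring⟩)
    (by intro s s' t; ext i x : 3
        simp only [Submodule.coe_add, Pi.add_apply, add_mul, mul_add]; abel)
    (by intro c s t; ext i x : 3
        simp only [Submodule.coe_smul, Pi.smul_apply, smul_mul_assoc, mul_smul_comm, smul_sub])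
    (by intro s t t'; ext i x : 3
        simp only [Submodule.coe_add, Pi.add_apply, add_mul, mul_add]; abel)
    (by intro c s t; ext i x : 3
        simp only [Submodule.coe_smul, Pi.smul_apply, smul_mul_assoc, mul_smul_comm, smul_sub])

variable (P)

/-- A Dolbeault operator `∂̄_P` on the principal bundle (equivalently, a holomorphic structure), `𝔨`
being the Lie algebra of `K`: over `U i` it is `∂̄ + A i dz̄ i` with `A i : U i → 𝔨` smooth, and
the `A i` transform like the `(0,1)`-part of a connection,
`A i = conj (dz j / dz i) • Ad (g i j) (A j) - (∂ (g i j) / ∂z̄ i) (g i j)⁻¹`. -/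
structure Dolbeault (𝔨 : Submodule ℂ (Mat n)) where
  /-- the coefficients `A i`, extended by zero to `X` -/
  A : P.ι → X → Mat n
  A_mem : ∀ i x, A i x ∈ 𝔨
  A_zero : ∀ i x, x ∉ P.U i → A i x = 0
  A_smooth : ∀ i a b, P.SmoothIn i (P.U i) (fun x => A i x a b)
  A_change : ∀ i j x, x ∈ P.U i → x ∈ P.U j →
    A i x * (P.g i j x : Mat n) =
      starRingEnd ℂ (P.jac i j x) • ((P.g i j x : Mat n) * A j x) -
        P.dbarMat i (fun y => (P.g i j y : Mat n)) x

variable {P}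

lemma form_differentiableAt {p q : ℕ} (s : P.Form V p q) {i : P.ι} {x : X} (hx : x ∈ P.U i)
    (a b : Fin n) :
    DifferentiableAt ℝ (fun w => s.1 i ((P.z i).symm w) a b) (P.z i x) :=
  SmoothIn.differentiableAt (s.2.2.2.1 i a b) (isOpen_U i) hx hx

lemma dbarMat_add (i : P.ι) {x : X} {s t : X → Mat n}
    (hs : ∀ a b, DifferentiableAt ℝ (fun w => s ((P.z i).symm w) a b) (P.z i x))
    (ht : ∀ a b, DifferentiableAt ℝ (fun w => t ((P.z i).symm w) a b) (P.z i x)) :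
    P.dbarMat i (fun y => s y + t y) x = P.dbarMat i s x + P.dbarMat i t x := by
  ext a b
  simp only [dbarMat, dbarFun, Matrix.of_apply, Matrix.add_apply]
  exact dbarAt_add (hs a b) (ht a b)

lemma dbarMat_smul (i : P.ι) {x : X} (c : ℂ) {s : X → Mat n}
    (hs : ∀ a b, DifferentiableAt ℝ (fun w => s ((P.z i).symm w) a b) (P.z i x)) :
    P.dbarMat i (fun y => c • s y) x = c • P.dbarMat i s x := by
  ext a b
  simp only [dbarMat, dbarFun, Matrix.of_apply, Matrix.smul_apply, smul_eq_mul]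
  exact dbarAt_const_mul c (hs a b)

lemma dbarMat_mem (i : P.ι) {x : X} {s : X → Mat n}
    (hs : ∀ a b, DifferentiableAt ℝ (fun w => s ((P.z i).symm w) a b) (P.z i x))
    (hV : ∀ y, s y ∈ V) : P.dbarMat i s x ∈ V := by
  by_contra hcon
  obtain ⟨L, hL, hLV⟩ := Submodule.exists_le_ker_of_notMem hcon
  apply hL
  have key : ∀ Y : Mat n, L Y = ∑ a, ∑ b, L (Matrix.single a b 1) * Y a b := by
    intro Y
    conv_lhs => rw [Matrix.matrix_eq_sum_single Y]
    simp only [map_sum]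
    refine Finset.sum_congr rfl fun a _ => Finset.sum_congr rfl fun b _ => ?_
    have : Matrix.single a b (Y a b) = Y a b • (Matrix.single a b 1 : Mat n) := by
      rw [Matrix.smul_single]; simp
    rw [this, map_smul, smul_eq_mul, mul_comm]
  have hzero : dbarAt (fun w => ∑ a, ∑ b, L (Matrix.single a b 1) * s ((P.z i).symm w) a b)
      (P.z i x) = 0 := by
    have : (fun w => ∑ a, ∑ b, L (Matrix.single a b 1) * s ((P.z i).symm w) a b)
        = fun _ => (0 : ℂ) := by
      funext w
      rw [← key]
      exact hLV (hV _)
    rw [this]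
    exact dbarAt_holomorphic (differentiableAt_const (𝕜 := ℂ) (0 : ℂ))
  rw [key, ← hzero, dbarAt_sum _ fun a _ => DifferentiableAt.fun_sum fun b _ =>
    (hs a b).const_mul _]
  refine Finset.sum_congr rfl fun a _ => ?_
  rw [dbarAt_sum _ fun b _ => (hs a b).const_mul _]
  refine Finset.sum_congr rfl fun b _ => ?_
  rw [dbarAt_const_mul _ (hs a b)]
  rfl

namespace Dolbeault

variable {𝔨 : Submodule ℂ (Mat n)} (D : P.Dolbeault 𝔨)

lemma A_differentiableAt {i : P.ι} {x : X} (hx : x ∈ P.U i) (a b : Fin n) :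
    DifferentiableAt ℝ (fun w => D.A i ((P.z i).symm w) a b) (P.z i x) :=
  SmoothIn.differentiableAt (D.A_smooth i a b) (isOpen_U i) hx hx

/-- The coefficient `∂(s i)/∂z̄ i + [A i, s i]`. -/
def coeff (s : P.ι → X → Mat n) (i : P.ι) (x : X) : Mat n :=
  P.dbarMat i (s i) x + (D.A i x * s i x - s i x * D.A i x)

open Classical in
/-- The Dolbeault operator `∂̄_P : Ω^{p,0}(P[V]) → Ω^{p,1}(P[V])`, `p ≤ 1`; its coefficient over `U i`
with respect to `dz̄ i` (if `p = 0`) or `dz̄ i ∧ dz i` (if `p = 1`) is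
`∂(s i)/∂z̄ i + [A i, s i]`. -/
def dbar (hV : ∀ Y ∈ 𝔨, ∀ Z ∈ V, Y * Z - Z * Y ∈ V) (p : ℕ) :
    P.Form V p 0 →ₗ[ℂ] P.Form V p 1 where
  toFun s := ⟨fun i x => if x ∈ P.U i then D.coeff s.1 i x else 0, by
    refine ⟨fun i x => ?_, fun i x hx => if_neg hx, fun i a b => ?_, fun i j x hi hj => ?_⟩
    · dsimp only
      split_ifs with hx
      · exact V.add_mem (dbarMat_mem i (fun a b => form_differentiableAt s hx a b) (s.2.1 i))
          (hV _ (D.A_mem i x) _ (s.2.1 i x))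
      · exact V.zero_mem
    · have h1 : P.SmoothIn i (P.U i) (P.dbarFun i (fun y => s.1 i y a b)) :=
        SmoothIn.dbarFun (s.2.2.2.1 i a b)
      have h2 := SmoothIn.commutator (D.A_smooth i) (s.2.2.2.1 i) a b
      refine (h1.add h2).congr fun x hx _ => ?_
      simp only [if_pos hx]
      rfl
    · simp only [if_pos hi, if_pos hj]
      have hs := s.2.2.2.2 i j
      have hA := D.A_change i j x hi hj
      have hsi : ∀ a b, DifferentiableAt ℝ (fun w => s.1 i ((P.z i).symm w) a b) (P.z i x) :=
        fun a b => form_differentiableAt s hi a b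
      have hg : ∀ a b, DifferentiableAt ℝ
          (fun w => (P.g i j ((P.z i).symm w) : Mat n) a b) (P.z i x) := fun a b =>
        SmoothIn.differentiableAt (N := P.U j) (f := fun y => (P.g i j y : Mat n) a b)
          (P.g_smooth i j a b) (isOpen_U j) hi hj
      have hxx : (P.z i).symm (P.z i x) = x := (P.z i).left_inv hi
      have hev := P.holomorphic_change i j hi hj
      -- the coordinate change is holomorphic, hence so is its derivative
      have hjac : DifferentiableAt ℂ (fun w => P.jac i j ((P.z i).symm w) ^ p) (P.z i x) := by
        have hd : DifferentiableAt ℂ (deriv (fun w => P.z j ((P.z i).symm w))) (P.z i x) := by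
          obtain ⟨O, hO, hOo, hxO⟩ := eventually_nhds_iff.1 hev
          have : DifferentiableOn ℂ (fun w => P.z j ((P.z i).symm w)) O :=
            fun w hw => (hO w hw).differentiableWithinAt
          exact (this.deriv hOo).differentiableAt (hOo.mem_nhds hxO)
        refine DifferentiableAt.pow (hd.congr_of_eventuallyEq ?_) p
        filter_upwards [P.eventually_mem i hi (isOpen_U i) hi] with w hw
        simp only [jac]
        rw [(P.z i).right_inv hw.1]
      have hjR : DifferentiableAt ℝ (fun w => P.jac i j ((P.z i).symm w) ^ p) (P.z i x) :=
        hjac.restrictScalars ℝ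
      -- the coefficient in the chart `j`, read in the chart `i`
      have hchart : ∀ a b, DifferentiableAt ℝ
          (fun w => s.1 j ((P.z i).symm w) a b) (P.z i x) := by
        intro a b
        have h1 := form_differentiableAt s hj a b
        have hk := hev.self_of_nhds.restrictScalars ℝ
        have h1' : DifferentiableAt ℝ (fun w => s.1 j ((P.z j).symm w) a b)
            ((fun w => P.z j ((P.z i).symm w)) (P.z i x)) := by
          simpa only [hxx] using h1
        refine (h1'.comp (P.z i x) hk).congr_of_eventuallyEq ?_
        filter_upwards [P.eventually_mem i hi (isOpen_U j) hj] with w hw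
        simp only [Function.comp_apply]
        rw [(P.z j).left_inv hw.2]
      have hconj : P.dbarMat i (s.1 j) x =
          starRingEnd ℂ (P.jac i j x) • P.dbarMat j (s.1 j) x := by
        ext a b
        simp only [dbarMat, Matrix.of_apply, Matrix.smul_apply, smul_eq_mul]
        exact P.dbarFun_change i j hi hj (form_differentiableAt s hj a b)
      -- differentiate `s i * g = (dz j / dz i)^p • g * s j`
      have hprod : P.dbarMat i (fun y => s.1 i y * (P.g i j y : Mat n)) x =
          P.jac i j x ^ p • P.dbarMat i (fun y => (P.g i j y : Mat n) * s.1 j y) x := by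
        ext a b
        simp only [dbarMat, Matrix.of_apply, Matrix.smul_apply, smul_eq_mul]
        rw [P.dbarFun_congr i hi (g := fun y => P.jac i j y ^ p *
          ((P.g i j y : Mat n) * s.1 j y) a b) (isOpen_U j) hj]
        · have hm : DifferentiableAt ℝ (fun w => ((P.g i j ((P.z i).symm w) : Mat n) *
              s.1 j ((P.z i).symm w)) a b) (P.z i x) := by
            simp only [Matrix.mul_apply]
            exact DifferentiableAt.fun_sum fun c _ => (hg a c).fun_mul (hchart c b)
          simp only [dbarFun]
          rw [dbarAt_mul hjR hm, dbarAt_holomorphic hjac, hxx, zero_mul, zero_add]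
        · intro y hy hy'
          rw [hs y hy hy']
          simp
      rw [P.dbarMat_mul i hi hsi hg, P.dbarMat_mul i hi hg hchart, hconj] at hprod
      have hsx := hs x hi hj
      simp only [pow_zero, mul_one] at hsx
      simp only [coeff, pow_one]
      set τ := P.jac i j x
      set c := starRingEnd ℂ τ
      set g := (P.g i j x : Mat n)
      set B := P.dbarMat i (fun y => (P.g i j y : Mat n)) x
      have e1 : D.A i x * s.1 i x * g = (τ ^ p * c) • (g * D.A j x * s.1 j x)
          - τ ^ p • (B * s.1 j x) := by
        rw [mul_assoc, hsx, mul_smul_comm, ← mul_assoc, hA, sub_mul, smul_sub, smul_mul_assoc,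
          smul_smul]
      have e2 : s.1 i x * D.A i x * g = (τ ^ p * c) • (g * s.1 j x * D.A j x)
          - s.1 i x * B := by
        rw [mul_assoc, hA, mul_sub, mul_smul_comm, ← mul_assoc, hsx, smul_mul_assoc, smul_smul,
          mul_comm c]
      have e3 : P.dbarMat i (s.1 i) x * g = τ ^ p • (B * s.1 j x) +
          (τ ^ p * c) • (g * P.dbarMat j (s.1 j) x) - s.1 i x * B := by
        rw [eq_sub_iff_add_eq, hprod, mul_smul_comm, smul_add, smul_smul]
      rw [add_mul, sub_mul, e1, e2, e3, mul_add, mul_sub, smul_add, smul_sub, ← mul_assoc,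
        ← mul_assoc]
      abel⟩
  map_add' s t := by
    ext i x : 3
    simp only [Submodule.coe_add, Pi.add_apply]
    split_ifs with hx
    · simp only [coeff, Pi.add_apply]
      have := dbarMat_add i (fun a b => form_differentiableAt s hx a b)
        (fun a b => form_differentiableAt t hx a b)
      change P.dbarMat i (fun y => s.1 i y + t.1 i y) x + _ = _
      rw [this, mul_add, add_mul]
      abel
    · simp
  map_smul' c s := by
    ext i x : 3
    simp only [Submodule.coe_smul, Pi.smul_apply, RingHom.id_apply]
    split_ifs with hx
    · simp only [coeff, Pi.smul_apply]
      have := dbarMat_smul i c (fun a b => form_differentiableAt s hx a b)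
      change P.dbarMat i (fun y => c • s.1 i y) x + _ = _
      rw [this, mul_smul_comm, smul_mul_assoc, smul_add, smul_sub]
    · simp

lemma dbar_apply (hV : ∀ Y ∈ 𝔨, ∀ Z ∈ V, Y * Z - Z * Y ∈ V) (p : ℕ) (s : P.Form V p 0)
    {i : P.ι} {x : X} (hx : x ∈ P.U i) :
    (D.dbar hV p s).1 i x =
      P.dbarMat i (s.1 i) x + (D.A i x * s.1 i x - s.1 i x * D.A i x) := by
  simp only [dbar, LinearMap.coe_mk, AddHom.coe_mk, if_pos hx]
  rfl

end Dolbeault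

end PrincipalBundle

/-! ### The associated holomorphic vector bundle, holomorphic subbundles and their degree -/

namespace PrincipalBundle.Dolbeault

variable {K : Subgroup (Matrix.SpecialLinearGroup (Fin n) ℂ)} {P : PrincipalBundle.{u, v} X K}
  {𝔨 : Submodule ℂ (Mat n)} (D : P.Dolbeault 𝔨)

/-- A family of subspaces of the fibres of `E = P[ℂⁿ]`, written over `U i` as `x ↦ F i x ⊆ ℂⁿ` (only
the values at points of `U i` matter). -/
abbrev FibreFamily (P : PrincipalBundle.{u, v} X K) : Type (max u v) :=
  P.ι → X → Submodule ℂ (Fin n → ℂ)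

/-- `e` is a holomorphic frame of `F` on the open set `N ⊆ U i`: the sections `e k` of `E` are smooth
with `∂̄_E (e k) = 0`, and at each point of `N` they form a basis of the fibre of `F`. -/
structure IsHolomorphicFrame (F : FibreFamily P) {r : ℕ} (i : P.ι) (N : Set X)
    (e : Fin r → X → Fin n → ℂ) : Prop where
  isOpen : IsOpen N
  subset : N ⊆ P.U i
  smooth : ∀ k a, P.SmoothIn i N (fun x => e k x a)
  holomorphic : ∀ k, ∀ x ∈ N, P.dbarVec i (e k) x + (D.A i x).mulVec (e k x) = 0
  linearIndependent : ∀ x ∈ N, LinearIndependent ℂ (fun k => e k x)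
  span_eq : ∀ x ∈ N, Submodule.span ℂ (Set.range fun k => e k x) = F i x

/-- `F` is a holomorphic subbundle of rank `r` of the holomorphic vector bundle `E = P[ℂⁿ]`. -/
structure IsHolomorphicSubbundle (F : FibreFamily P) (r : ℕ) : Prop where
  change : ∀ i j x, x ∈ P.U i → x ∈ P.U j →
    ∀ v ∈ F j x, (P.g i j x : Mat n).mulVec v ∈ F i x
  frame : ∀ i, ∀ x ∈ P.U i, ∃ (N : Set X) (e : Fin r → X → Fin n → ℂ),
    x ∈ N ∧ D.IsHolomorphicFrame F i N e

/-- The holomorphic subbundle `F` of rank `r` has degree `d`: there is a global meromorphic frame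
`s 1, …, s r` of `F` for which the meromorphic section `s 1 ∧ … ∧ s r` of the line bundle `det F` has
order `ord x` at each point `x`, and these orders add up to `d`. In a holomorphic frame `e` near `x`
one writes `s l = ∑ k, M k l • e k` with `M` a matrix of meromorphic functions of the coordinate;
then `ord x` is the order of `det M`. -/
def HasDegree (F : FibreFamily P) (r : ℕ) (d : ℤ) : Prop :=
  ∃ (S : Finset X) (s : Fin r → P.ι → X → Fin n → ℂ) (ord : X → ℤ),
    (∀ l i j x, x ∉ S → x ∈ P.U i → x ∈ P.U j →
      s l i x = (P.g i j x : Mat n).mulVec (s l j x)) ∧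
    (∀ x, x ∉ S → ord x = 0) ∧
    (∀ i, ∀ x ∈ P.U i, ∃ (N : Set X) (e : Fin r → X → Fin n → ℂ)
      (M : ℂ → Matrix (Fin r) (Fin r) ℂ),
      x ∈ N ∧ D.IsHolomorphicFrame F i N e ∧
      (∀ k l, MeromorphicAt (fun w => M w k l) (P.z i x)) ∧
      (∀ᶠ y in nhdsWithin x {x}ᶜ, ∀ l, s l i y = ∑ k, M (P.z i y) k l • e k y) ∧
      meromorphicOrderAt (fun w => (M w).det) (P.z i x) = (ord x : WithTop ℤ)) ∧
    d = ∑ x ∈ S, ord x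

end PrincipalBundle.Dolbeault

/-! ### Higgs bundles -/

/-- A `G`-Higgs bundle `(∂̄_P, φ)` with underlying smooth principal `Hᶜ`-bundle `P`: a Dolbeault operator
on `P` and a section `φ ∈ Ω^{1,0}(P[𝔪ᶜ])` with `∂̄_P φ = 0`. -/
structure HiggsBundle (R : RealForm n) (P : PrincipalBundle.{u, v} X R.HC) where
  D : P.Dolbeault R.hC
  φ : P.Form R.mC 1 0
  dbar_φ : D.dbar R.bracket_hC_mC 1 φ = 0

namespace HiggsBundle

variable {R : RealForm n} {P : PrincipalBundle.{u, v} X R.HC} (E : HiggsBundle R P)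

/-! #### Stability -/

/-- `Φ (F) ⊆ F ⊗ K`, where `(E, Φ)` is the associated `SL(n, ℂ)`-Higgs bundle. -/
def Invariant (F : PrincipalBundle.Dolbeault.FibreFamily P) : Prop :=
  ∀ i, ∀ x ∈ P.U i, ∀ v ∈ F i x, (E.φ.1 i x).mulVec v ∈ F i x

/-- The invariant holomorphic subbundle `F` of rank `r`, with the Higgs field induced by `Φ`, is a
stable Higgs bundle of degree `0`: its invariant holomorphic subbundles `F'` of rank strictly between
`0` and `r` have negative degree. -/
def IsStableOfDegreeZero (F : PrincipalBundle.Dolbeault.FibreFamily P) (r : ℕ) : Prop :=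
  E.D.HasDegree F r 0 ∧
  ∀ (F' : PrincipalBundle.Dolbeault.FibreFamily P) (r' : ℕ), 0 < r' → r' < r →
    E.D.IsHolomorphicSubbundle F' r' → E.Invariant F' → (∀ i, ∀ x ∈ P.U i, F' i x ≤ F i x) →
    ∀ d : ℤ, E.D.HasDegree F' r' d → d < 0

/-- Polystability: the associated `SL(n, ℂ)`-Higgs bundle `(E, Φ)` is a direct sum of stable Higgs
bundles `(E j, Φ j)` of degree `0`. -/
def IsPolystable : Prop :=
  ∃ (k : ℕ) (F : Fin k → PrincipalBundle.Dolbeault.FibreFamily P) (r : Fin k → ℕ),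
    (∀ j, 0 < r j ∧ E.D.IsHolomorphicSubbundle (F j) (r j) ∧ E.Invariant (F j) ∧
      E.IsStableOfDegreeZero (F j) (r j)) ∧
    ∀ i, ∀ x ∈ P.U i, DirectSum.IsInternal fun j => F j i x

/-- The gauge group `Ω⁰(P[Hᶜ])`: smooth sections of the bundle of groups associated with the conjugation
action, written over `U i` as `u i : U i → Hᶜ` with `u i = g i j * u j * (g i j)⁻¹` (extended by `1`
to `X`). -/
def gaugeGroup (P : PrincipalBundle.{u, v} X R.HC) :
    Set (P.ι → X → Matrix.SpecialLinearGroup (Fin n) ℂ) :=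
  {u | (∀ i x, u i x ∈ R.HC) ∧ (∀ i x, x ∉ P.U i → u i x = 1) ∧
    (∀ i a b, P.SmoothIn i (P.U i) (fun x => (u i x : Mat n) a b)) ∧
    ∀ i j x, x ∈ P.U i → x ∈ P.U j → u i x = P.g i j x * u j x * (P.g i j x)⁻¹}

/-- The automorphism group of `(∂̄_P, φ)`: the gauge transformations `u` that preserve `∂̄_P`, that is
`∂̄u + A u = u A`, and `φ`, that is `φ u = u φ`. -/
def automorphisms : Set (P.ι → X → Matrix.SpecialLinearGroup (Fin n) ℂ) :=
  {u | u ∈ gaugeGroup P ∧ ∀ i, ∀ x ∈ P.U i,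
    P.dbarMat i (fun y => (u i y : Mat n)) x + E.D.A i x * (u i x : Mat n) =
      (u i x : Mat n) * E.D.A i x ∧
    E.φ.1 i x * (u i x : Mat n) = (u i x : Mat n) * E.φ.1 i x}

/-- Stability of a `G`-Higgs bundle, for `G` a real form of a complex semisimple group: polystability
together with finiteness of the automorphism group. -/
def IsStable : Prop := E.IsPolystable ∧ E.automorphisms.Finite

/-! #### Cohomology and the tangent space -/

/-- `∂̄_P : Ω⁰(P[𝔥ᶜ]) → Ω^{0,1}(P[𝔥ᶜ])`. -/
def dbarH : P.Form R.hC 0 0 →ₗ[ℂ] P.Form R.hC 0 1 := E.D.dbar R.bracket_hC_hC 0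

/-- `∂̄_P : Ω^{1,0}(P[𝔪ᶜ]) → Ω^{1,1}(P[𝔪ᶜ])`. -/
def dbarM : P.Form R.mC 1 0 →ₗ[ℂ] P.Form R.mC 1 1 := E.D.dbar R.bracket_hC_mC 1

/-- `ad_φ : Ω⁰(P[𝔥ᶜ]) → Ω^{1,0}(P[𝔪ᶜ])`, `x ↦ [φ, x]`. -/
def ad₀ : P.Form R.hC 0 0 →ₗ[ℂ] P.Form R.mC 1 0 :=
  PrincipalBundle.bracket R.bracket_mC_hC (add_zero 1).symm (add_zero 0).symm E.φ

/-- `ad_φ : Ω^{0,1}(P[𝔥ᶜ]) → Ω^{1,1}(P[𝔪ᶜ])`, `α ↦ [α, φ] = [φ, α]` (the bracket of one-forms is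
symmetric). -/
def ad₁ : P.Form R.hC 0 1 →ₗ[ℂ] P.Form R.mC 1 1 :=
  (PrincipalBundle.bracket R.bracket_hC_mC (zero_add 1).symm (add_zero 1).symm).flip E.φ

/-- `H⁰(P[𝔥ᶜ])`: holomorphic sections. -/
abbrev H0h : Submodule ℂ (P.Form R.hC 0 0) := LinearMap.ker E.dbarH

/-- `H⁰(P[𝔪ᶜ] ⊗ K)`: holomorphic sections. -/
abbrev H0mK : Submodule ℂ (P.Form R.mC 1 0) := LinearMap.ker E.dbarM

/-- `H¹(P[𝔥ᶜ])`, as Dolbeault cohomology. -/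
abbrev H1h : Type _ := P.Form R.hC 0 1 ⧸ LinearMap.range E.dbarH

/-- `H¹(P[𝔪ᶜ] ⊗ K)`, as Dolbeault cohomology. -/
abbrev H1mK : Type _ := P.Form R.mC 1 1 ⧸ LinearMap.range E.dbarM

/-- The linearization `(α, ψ) ↦ ∂̄_P ψ + [α, φ]` of the equation
`(∂̄_P + α) (φ + ψ) = 0`. -/
def linearization : P.Form R.hC 0 1 × P.Form R.mC 1 0 →ₗ[ℂ] P.Form R.mC 1 1 :=
  E.dbarM ∘ₗ LinearMap.snd ℂ _ _ + E.ad₁ ∘ₗ LinearMap.fst ℂ _ _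

/-- The tangent space at `(∂̄_P, φ)` to the space of Higgs bundles with underlying bundle `P`:
`{(α, ψ) | ∂̄_P ψ + [α, φ] = 0}`. -/
def TH : Type _ := LinearMap.ker E.linearization

instance : AddCommGroup E.TH := inferInstanceAs (AddCommGroup (LinearMap.ker E.linearization))

instance : Module ℂ E.TH := inferInstanceAs (Module ℂ (LinearMap.ker E.linearization))

/-- The infinitesimal action `x ↦ (∂̄_P x, [φ, x])` of the Lie algebra `Ω⁰(P[𝔥ᶜ])` of the gauge
group. -/
def gaugeAction : P.Form R.hC 0 0 →ₗ[ℂ] P.Form R.hC 0 1 × P.Form R.mC 1 0 :=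
  E.dbarH.prod E.ad₀

/-- As `φ` is holomorphic, `∂̄_P [φ, x] = -[φ, ∂̄_P x]`. -/
lemma dbarM_ad₀ (x : P.Form R.hC 0 0) : E.dbarM (E.ad₀ x) = -E.ad₁ (E.dbarH x) := by
  ext i y : 3
  by_cases hy : y ∈ P.U i
  · have hφ := E.D.dbar_apply R.bracket_hC_mC 1 E.φ hy
    rw [E.dbar_φ] at hφ
    have hx := E.D.dbar_apply R.bracket_hC_hC 0 x hy
    have h1 : P.dbarMat i ((E.ad₀ x).1 i) y =
        (P.dbarMat i (E.φ.1 i) y * x.1 i y + E.φ.1 i y * P.dbarMat i (x.1 i) y) -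
        (P.dbarMat i (x.1 i) y * E.φ.1 i y + x.1 i y * P.dbarMat i (E.φ.1 i) y) := by
      have dφ := fun a b => PrincipalBundle.form_differentiableAt E.φ hy a b
      have dx := fun a b => PrincipalBundle.form_differentiableAt x hy a b
      have d1 : ∀ a b, DifferentiableAt ℝ (fun w => (E.φ.1 i ((P.z i).symm w) *
          x.1 i ((P.z i).symm w)) a b) (P.z i y) := by
        intro a b
        simp only [Matrix.mul_apply]
        exact DifferentiableAt.fun_sum fun c _ => (dφ a c).fun_mul (dx c b)
      have d2 : ∀ a b, DifferentiableAt ℝ (fun w => (x.1 i ((P.z i).symm w) *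
          E.φ.1 i ((P.z i).symm w)) a b) (P.z i y) := by
        intro a b
        simp only [Matrix.mul_apply]
        exact DifferentiableAt.fun_sum fun c _ => (dx a c).fun_mul (dφ c b)
      have := P.dbarMat_sub i (s := fun z => E.φ.1 i z * x.1 i z)
        (t := fun z => x.1 i z * E.φ.1 i z) d1 d2
      rw [P.dbarMat_mul i hy dφ dx, P.dbarMat_mul i hy dx dφ] at this
      exact this
    have h2 := E.D.dbar_apply R.bracket_hC_mC 1 (E.ad₀ x) hy
    have h3 : (E.ad₀ x).1 i y = E.φ.1 i y * x.1 i y - x.1 i y * E.φ.1 i y := rfl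
    have h4 : (-E.ad₁ (E.dbarH x)).1 i y =
        -((E.dbarH x).1 i y * E.φ.1 i y - E.φ.1 i y * (E.dbarH x).1 i y) := rfl
    have h5 : P.dbarMat i (E.φ.1 i) y =
        E.φ.1 i y * E.D.A i y - E.D.A i y * E.φ.1 i y := by
      have : (0 : Mat n) = P.dbarMat i (E.φ.1 i) y +
        (E.D.A i y * E.φ.1 i y - E.φ.1 i y * E.D.A i y) := hφ
      rw [eq_comm, add_eq_zero_iff_eq_neg] at this
      rw [this]; abel
    change ((E.D.dbar R.bracket_hC_mC 1) (E.ad₀ x)).1 i y = _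
    rw [h2, h1, h3, h4]
    change _ = -(((E.D.dbar R.bracket_hC_hC 0) x).1 i y * E.φ.1 i y -
      E.φ.1 i y * ((E.D.dbar R.bracket_hC_hC 0) x).1 i y)
    rw [hx, h5]
    noncomm_ring
  · exact ((E.dbarM (E.ad₀ x)).2.2.1 i y hy).trans
      ((-E.ad₁ (E.dbarH x)).2.2.1 i y hy).symm

lemma gaugeAction_mem (x : P.Form R.hC 0 0) : E.gaugeAction x ∈ LinearMap.ker E.linearization := by
  change E.dbarM (E.ad₀ x) + E.ad₁ (E.dbarH x) = 0
  rw [dbarM_ad₀, neg_add_cancel]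

/-- The infinitesimal action, as a map into `TH`. -/
def gaugeActionTH : P.Form R.hC 0 0 →ₗ[ℂ] E.TH :=
  E.gaugeAction.codRestrict (LinearMap.ker E.linearization) E.gaugeAction_mem

/-- The inclusion `ψ ↦ (0, ψ)` of `H⁰(P[𝔪ᶜ] ⊗ K)` into `TH`. -/
def inclTH : E.H0mK →ₗ[ℂ] E.TH :=
  (LinearMap.inr ℂ (P.Form R.hC 0 1) (P.Form R.mC 1 0)).restrict (p := E.H0mK)
    (q := LinearMap.ker E.linearization) fun ψ hψ => by
      change E.dbarM ψ + E.ad₁ 0 = 0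
      rw [LinearMap.mem_ker.1 hψ, map_zero, add_zero]

/-- The projection `(α, ψ) ↦ α` on `TH`. -/
def projTH : E.TH →ₗ[ℂ] P.Form R.hC 0 1 :=
  LinearMap.fst ℂ (P.Form R.hC 0 1) (P.Form R.mC 1 0) ∘ₗ (LinearMap.ker E.linearization).subtype

/-- The tangent space at `(∂̄_P, φ)` to its gauge orbit, as a subspace of `TH`. -/
def TOrbit : Submodule ℂ E.TH := LinearMap.range E.gaugeActionTH

/-- The tangent space at `[∂̄_P, φ]` to the moduli space of `G`-Higgs bundles:
`{(α, ψ) | ∂̄_P ψ + [α, φ] = 0} / {(∂̄_P x, [φ, x])}`. -/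
abbrev TM : Type _ := E.TH ⧸ E.TOrbit

/-! #### The maps of the sequence -/

/-- `ad_φ : H⁰(P[𝔥ᶜ]) → H⁰(P[𝔪ᶜ] ⊗ K)`. -/
def adH0 : E.H0h →ₗ[ℂ] E.H0mK :=
  E.ad₀.restrict fun x hx => by
    rw [LinearMap.mem_ker, dbarM_ad₀, LinearMap.mem_ker.1 hx, map_zero, neg_zero]

/-- `i : H⁰(P[𝔪ᶜ] ⊗ K) → T M(G)`, induced by `ψ ↦ (0, ψ)`. -/
def incl : E.H0mK →ₗ[ℂ] E.TM := E.TOrbit.mkQ ∘ₗ E.inclTH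

/-- `π : T M(G) → H¹(P[𝔥ᶜ])`, induced by `(α, ψ) ↦ α`. -/
def proj : E.TM →ₗ[ℂ] E.H1h :=
  E.TOrbit.mapQ (LinearMap.range E.dbarH) E.projTH <| by
    rintro _ ⟨x, rfl⟩
    exact ⟨x, rfl⟩

/-- `ad_φ : H¹(P[𝔥ᶜ]) → H¹(P[𝔪ᶜ] ⊗ K)`, induced by `α ↦ [α, φ]`. -/
def adH1 : E.H1h →ₗ[ℂ] E.H1mK :=
  (LinearMap.range E.dbarH).mapQ (LinearMap.range E.dbarM) E.ad₁ <| by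
    rintro _ ⟨x, rfl⟩
    exact ⟨-E.ad₀ x, by rw [map_neg, dbarM_ad₀, neg_neg]⟩

end HiggsBundle

end

end HiggsTangent

/-! The tangent space is the middle cohomology of the three-term complex `x ↦ (∂̄_P x, [φ, x])`,
`(α, ψ) ↦ ∂̄_P ψ + [α, φ]`. It is a complex because `φ` is holomorphic, in the form `∂̄_P [φ, x] =
-[φ, ∂̄_P x]` (`dbarM_ad₀`). The sequence is a piece of its long exact cohomology sequence.
Exactness at the three inner terms is therefore a diagram chase resting on that identity and its
sign.

Injectivity at the left end is where stability enters. A section `s` with `∂̄_P s = 0` and `[φ, s] =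
0` is an infinitesimal automorphism, and `exp (t s)`, `t ∈ ℂ`, is a family of automorphisms of
`(∂̄_P, φ)`. If there are finitely many automorphisms, then at each point `t ↦ exp (t s(x))` takes
finitely many values. Being continuous on a connected set it is constant, and its derivative at `0`
gives `s(x) = 0` (`eq_zero_of_finite_automorphisms`).

The analytic work is to show that `exp s` is an automorphism (`gaugeExp_mem_automorphisms`). It lies
in `SL(n, ℂ)` because `𝔥ᶜ` is traceless. It preserves `∂̄_P` because `d exp` at `Y` sends `[Y, B]`
to `[exp Y, B]` (`fderiv_exp_commutator`), so that `∂̄s = [s, A]` exponentiates to `∂̄(exp s) = [exp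
s, A]` although `s` and `∂̄s` need not commute. -/

namespace HiggsTangent

/-! ### The exponential of a Banach algebra -/

section BanachAlgebra

variable {𝔸 : Type*} [NormedRing 𝔸] [NormedAlgebra ℂ 𝔸] [CompleteSpace 𝔸]

/-- The derivative of `exp` at `Y` in the direction `[Y, B]` is `[exp Y, B]`. -/
lemma fderiv_exp_commutator (Y B : 𝔸) :
    fderiv ℂ (NormedSpace.exp : 𝔸 → 𝔸) Y (Y * B - B * Y) =
      NormedSpace.exp Y * B - B * NormedSpace.exp Y := by
  let : NormedAlgebra ℚ 𝔸 := NormedAlgebra.restrictScalars ℚ ℂ 𝔸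
  -- The commutator is the velocity at `0` of the conjugation orbit `e^{-tB} Z e^{tB}`. As `exp`
  -- commutes with conjugation, it carries the orbit of `Y` to that of `exp Y`; comparing velocities
  -- avoids the series for `d exp`.
  have hconj : ∀ Z : 𝔸, HasDerivAt (fun t : ℂ => NormedSpace.exp (t • -B) * Z *
      NormedSpace.exp (t • B)) (Z * B - B * Z) 0 := by
    intro Z
    have h1 := hasDerivAt_exp_smul_const (𝕂 := ℂ) (-B) 0
    have h2 := hasDerivAt_exp_smul_const (𝕂 := ℂ) B 0
    have := (h1.mul_const Z).mul h2
    simp only [zero_smul, NormedSpace.exp_zero, one_mul, mul_one, neg_mul] at this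
    rwa [neg_add_eq_sub] at this
  have hexp : ∀ t : ℂ, NormedSpace.exp (NormedSpace.exp (t • -B) * Y * NormedSpace.exp (t • B)) =
      NormedSpace.exp (t • -B) * NormedSpace.exp Y * NormedSpace.exp (t • B) := fun t => by
    have hc : Commute (t • -B) (t • B) :=
      (((Commute.refl B).neg_left).smul_left t).smul_right t
    have h1 : NormedSpace.exp (t • -B) * NormedSpace.exp (t • B) = 1 := by
      rw [← NormedSpace.exp_add_of_commute hc]; simp
    have h2 : NormedSpace.exp (t • B) * NormedSpace.exp (t • -B) = 1 := by
      rw [← NormedSpace.exp_add_of_commute hc.symm]; simp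
    exact NormedSpace.exp_units_conj ⟨_, _, h1, h2⟩ Y
  have hd : HasFDerivAt (NormedSpace.exp : 𝔸 → 𝔸) (fderiv ℂ (NormedSpace.exp : 𝔸 → 𝔸) Y)
      (NormedSpace.exp ((0 : ℂ) • -B) * Y * NormedSpace.exp ((0 : ℂ) • B)) := by
    simpa using (NormedSpace.exp_analytic (𝕂 := ℂ) Y).differentiableAt.hasFDerivAt
  have h := hd.comp_hasDerivAt 0 (hconj Y)
  rw [show NormedSpace.exp ∘ (fun t : ℂ => NormedSpace.exp (t • -B) * Y * NormedSpace.exp (t • B)) =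
    fun t => NormedSpace.exp (t • -B) * NormedSpace.exp Y * NormedSpace.exp (t • B) from
      funext hexp] at h
  exact h.unique (hconj _)

/-- An element whose complex one-parameter group takes finitely many values vanishes. -/
lemma eq_zero_of_finite_range_exp {Y : 𝔸}
    (hY : (Set.range fun t : ℂ => NormedSpace.exp (t • Y)).Finite) : Y = 0 := by
  have hd := fun t : ℂ => hasDerivAt_exp_smul_const (𝕂 := ℂ) Y t
  have hc : Continuous fun t : ℂ => NormedSpace.exp (t • Y) :=
    continuous_iff_continuousAt.2 fun t => (hd t).continuousAt
  -- The range is the continuous image of `ℂ`, hence connected; a connected set with two points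
  -- would be infinite.
  have hs : (Set.range fun t : ℂ => NormedSpace.exp (t • Y)).Subsingleton := by
    by_contra hcon
    exact (isPreconnected_range hc).infinite_of_nontrivial
      (Set.not_subsingleton_iff.1 hcon) hY
  have h1 : (fun t : ℂ => NormedSpace.exp (t • Y)) = fun _ => 1 := by
    funext t
    simpa using hs ⟨t, rfl⟩ ⟨0, rfl⟩
  have h := hd 0
  rw [h1] at h
  simpa using h.unique (hasDerivAt_const (0 : ℂ) (1 : 𝔸))

end BanachAlgebra

/-! ### The matrix exponential -/

section MatrixExponential

-- This submultiplicative norm makes matrices a Banach algebra and induces the entrywise topology.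
attribute [local instance] Matrix.linftyOpNormedRing Matrix.linftyOpNormedAlgebra

variable {n : ℕ}

/-- The entry `(a, b)` of a matrix, as a continuous linear map. -/
noncomputable def entryCLM (a b : Fin n) : Mat n →L[ℂ] ℂ :=
  LinearMap.toContinuousLinearMap (Matrix.entryLinearMap ℂ ℂ a b)

/-- Smoothness of forms is an entrywise condition, while the chain rule with `exp` needs the
derivative of the whole matrix; expanding in matrix units passes from one to the other. -/
lemma hasFDerivAt_matrix {E : Type*} [NormedAddCommGroup E] [NormedSpace ℝ E] {s : E → Mat n}
    {z : E} (hs : ∀ a b, DifferentiableAt ℝ (fun w => s w a b) z) :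
    HasFDerivAt s (∑ a, ∑ b, (fderiv ℝ (fun w => s w a b) z).smulRight
      (Matrix.single a b (1 : ℂ))) z := by
  have h : s = fun w => ∑ a, ∑ b, s w a b • Matrix.single a b (1 : ℂ) := by
    funext w
    conv_lhs => rw [Matrix.matrix_eq_sum_single (s w)]
    simp [Matrix.smul_single]
  refine HasFDerivAt.congr_of_eventuallyEq (HasFDerivAt.fun_sum fun a _ =>
    HasFDerivAt.fun_sum fun b _ =>
      (hs a b).hasFDerivAt.smul_const (Matrix.single a b (1 : ℂ) : Mat n)) ?_
  exact Filter.Eventually.of_forall (congrFun h)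

lemma contDiffOn_matrix {E : Type*} [NormedAddCommGroup E] [NormedSpace ℝ E] {s : E → Mat n}
    {O : Set E} (hs : ∀ a b, ContDiffOn ℝ ∞ (fun w => s w a b) O) : ContDiffOn ℝ ∞ s O := by
  have h : s = fun w => ∑ a, ∑ b, s w a b • Matrix.single a b (1 : ℂ) := by
    funext w
    conv_lhs => rw [Matrix.matrix_eq_sum_single (s w)]
    simp [Matrix.smul_single]
  rw [h]
  exact ContDiffOn.sum fun a _ => ContDiffOn.sum fun b _ => (hs a b).smul contDiffOn_const

lemma contDiffOn_exp_apply {s : ℂ → Mat n} {O : Set ℂ}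
    (hs : ∀ a b, ContDiffOn ℝ ∞ (fun w => s w a b) O) (a b : Fin n) :
    ContDiffOn ℝ ∞ (fun w => NormedSpace.exp (s w) a b) O := by
  have he : ContDiff ℝ ∞ (NormedSpace.exp : Mat n → Mat n) :=
    contDiff_iff_contDiffAt.2 fun Y => (NormedSpace.exp_analytic (𝕂 := ℝ) Y).contDiffAt
  exact ((entryCLM a b).restrictScalars ℝ).contDiff.comp_contDiffOn
    (he.comp_contDiffOn (contDiffOn_matrix hs))

/-- If `∂s/∂z̄ = [s, B]` at `z`, then `∂(exp s)/∂z̄ = [exp s, B]` at `z`. -/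
lemma dbarAt_exp {s : ℂ → Mat n} {z : ℂ} {B : Mat n}
    (hs : ∀ a b, DifferentiableAt ℝ (fun w => s w a b) z)
    (hB : Matrix.of (fun a b => dbarAt (fun w => s w a b) z) = s z * B - B * s z) (a b : Fin n) :
    dbarAt (fun w => NormedSpace.exp (s w) a b) z =
      (NormedSpace.exp (s z) * B - B * NormedSpace.exp (s z)) a b := by
  have hd := hasFDerivAt_matrix hs
  set s' := ∑ a, ∑ b, (fderiv ℝ (fun w => s w a b) z).smulRight (Matrix.single a b (1 : ℂ))
  -- As `exp` is holomorphic, its differential `L` is complex linear, so `∂(exp s)/∂z̄ = L (∂s/∂z̄)`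
  -- with no term in `∂s/∂z`.
  set L := fderiv ℂ (NormedSpace.exp : Mat n → Mat n) (s z) with hL
  have he : HasFDerivAt (NormedSpace.exp : Mat n → Mat n) (L.restrictScalars ℝ) (s z) :=
    (NormedSpace.exp_analytic (𝕂 := ℂ) (s z)).differentiableAt.hasFDerivAt.restrictScalars ℝ
  have h1 : HasFDerivAt (fun w => NormedSpace.exp (s w) a b)
      (((entryCLM a b).restrictScalars ℝ).comp ((L.restrictScalars ℝ).comp s')) z :=
    ((entryCLM a b).restrictScalars ℝ).hasFDerivAt.comp z (he.comp z hd)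
  have h2 : ∀ v : ℂ, ∀ a b, fderiv ℝ (fun w => s w a b) z v = s' v a b := by
    intro v a b
    have : HasFDerivAt (fun w => s w a b) (((entryCLM a b).restrictScalars ℝ).comp s') z :=
      ((entryCLM a b).restrictScalars ℝ).hasFDerivAt.comp z hd
    rw [this.fderiv]
    rfl
  have h3 : (1 / 2 : ℂ) • (s' 1 + Complex.I • s' Complex.I) = s z * B - B * s z := by
    rw [← hB]
    ext a b
    simp only [dbarAt, h2, Matrix.smul_apply, Matrix.add_apply, Matrix.of_apply, smul_eq_mul]
  have h4 : L ((1 / 2 : ℂ) • (s' 1 + Complex.I • s' Complex.I)) =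
      NormedSpace.exp (s z) * B - B * NormedSpace.exp (s z) := by
    rw [h3]
    exact fderiv_exp_commutator (s z) B
  rw [map_smul, map_add, map_smul] at h4
  refine Eq.trans ?_ (congrArg (fun M : Mat n => M a b) h4)
  rw [dbarAt, h1.fderiv]
  rfl

/-! ### Determinant and trace of the exponential -/

/-- The differential of `det` at the identity is the trace, which settles `t = 0`; the one-parameter
group law transports this to every `t`. -/
lemma hasDerivAt_det_exp_smul (Y : Mat n) (t : ℂ) :
    HasDerivAt (fun t : ℂ => (NormedSpace.exp (t • Y)).det)
      ((NormedSpace.exp (t • Y)).det * Y.trace) t := by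
  have hdet : Differentiable ℂ (Matrix.det : Mat n → ℂ) := by
    have : (Matrix.det : Mat n → ℂ) = fun M =>
        ∑ σ : Equiv.Perm (Fin n), (Equiv.Perm.sign σ : ℂ) * ∏ i, entryCLM (σ i) i M := by
      funext M
      rw [Matrix.det_apply']
      rfl
    rw [this]
    fun_prop
  have hone : fderiv ℂ (Matrix.det : Mat n → ℂ) 1 Y = Y.trace := by
    have h1 : HasDerivAt (fun t : ℂ => (1 : Mat n) + t • Y) ((1 : ℂ) • Y) 0 :=
      ((hasDerivAt_id (0 : ℂ)).smul_const Y).const_add (1 : Mat n)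
    have h0 : HasFDerivAt (Matrix.det : Mat n → ℂ) (fderiv ℂ (Matrix.det : Mat n → ℂ) 1)
        ((1 : Mat n) + (0 : ℂ) • Y) := by
      rw [zero_smul, add_zero]
      exact (hdet 1).hasFDerivAt
    have h3 := h0.comp_hasDerivAt 0 h1
    rw [one_smul] at h3
    refine h3.unique ?_
    -- `det (1 + tY) = 1 + t tr Y + t² q(t)` with `q` a polynomial, so the last term does not
    -- contribute at `0`.
    have h2 := (((hasDerivAt_id (0 : ℂ)).const_mul Y.trace).const_add 1).add
      ((((1 + (Polynomial.X : Polynomial ℂ) • Y.map Polynomial.C).det.divX.divX).hasDerivAt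
        0).mul ((hasDerivAt_id (0 : ℂ)).pow 2))
    have hp : ((id : ℂ → ℂ) ^ 2) 0 = 0 := by simp
    simp only [id, mul_one, mul_zero, Nat.cast_ofNat, Nat.add_one_sub_one, pow_one, hp,
      add_zero] at h2
    exact h2.congr_of_eventuallyEq (Filter.Eventually.of_forall fun t => Matrix.det_one_add_smul t Y)
  have hzero : HasDerivAt (fun t : ℂ => (NormedSpace.exp (t • Y)).det) Y.trace 0 := by
    have h1 := hasDerivAt_exp_smul_const (𝕂 := ℂ) Y 0
    have h0 : HasFDerivAt (Matrix.det : Mat n → ℂ) (fderiv ℂ (Matrix.det : Mat n → ℂ) 1)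
        (NormedSpace.exp ((0 : ℂ) • Y)) := by
      rw [zero_smul, NormedSpace.exp_zero]
      exact (hdet 1).hasFDerivAt
    have := h0.comp_hasDerivAt 0 h1
    rw [zero_smul, NormedSpace.exp_zero, one_mul] at this
    rw [← hone]
    exact this
  have hshift : (fun u : ℂ => (NormedSpace.exp (u • Y)).det) =
      fun u => (NormedSpace.exp (t • Y)).det * (NormedSpace.exp ((u - t) • Y)).det := by
    funext u
    rw [← Matrix.det_mul, ← Matrix.exp_add_of_commute, ← add_smul, add_sub_cancel]
    exact ((Commute.refl Y).smul_left t).smul_right (u - t)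
  rw [hshift]
  have h := hzero
  rw [← sub_self t] at h
  exact (h.comp_sub_const t t).const_mul _

lemma det_exp_eq_one {Y : Mat n} (hY : Y.trace = 0) : (NormedSpace.exp Y).det = 1 := by
  have h := is_const_of_deriv_eq_zero (f := fun t : ℂ => (NormedSpace.exp (t • Y)).det)
    (fun t => (hasDerivAt_det_exp_smul Y t).differentiableAt)
    (fun t => by rw [(hasDerivAt_det_exp_smul Y t).deriv, hY, mul_zero]) 1 0
  simpa using h

/-- Differentiate `det exp (tY) = 1` at `t = 0`, along real `t` only, since the one-parameter group
is known to stay in `K` only there. -/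
lemma TangentToSubgroup.trace_eq_zero {K : Subgroup (Matrix.SpecialLinearGroup (Fin n) ℂ)}
    {Y : Mat n} (hY : TangentToSubgroup K Y) : Y.trace = 0 := by
  have h0 := (hasDerivAt_det_exp_smul Y ((0 : ℝ) : ℂ)).comp_ofReal
  have h1 : (fun t : ℝ => (NormedSpace.exp ((t : ℂ) • Y)).det) = fun _ => 1 := by
    funext t
    obtain ⟨k, -, hk⟩ := hY t
    rw [Complex.coe_smul, ← hk, k.det_coe]
  rw [h1] at h0
  simpa using h0.unique (hasDerivAt_const (0 : ℝ) (1 : ℂ))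

/-- A matrix whose complex one-parameter group takes finitely many values vanishes. -/
lemma matrix_eq_zero_of_finite_range_exp {Y : Mat n}
    (hY : (Set.range fun t : ℂ => NormedSpace.exp (t • Y)).Finite) : Y = 0 :=
  eq_zero_of_finite_range_exp hY

end MatrixExponential

/-! ### The exponential of the gauge group and the exact sequence -/

universe u v

variable {n : ℕ} {X : Type u} [TopologicalSpace X] [ChartedSpace ℂ X]

namespace RealForm

variable (R : RealForm n)

/-- The trace is complex linear, so its vanishing passes from `𝔥` to the complex span. -/
lemma trace_eq_zero_of_mem_hC {Y : Mat n} (hY : Y ∈ R.hC) : Y.trace = 0 := by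
  have h : R.hC ≤ LinearMap.ker (Matrix.traceLinearMap (Fin n) ℂ ℂ) :=
    Submodule.span_le.2 fun Z hZ => ((R.mem_h Z).1 hZ).trace_eq_zero
  exact h hY

/-- The exponential `𝔥ᶜ → SL(n, ℂ)`. -/
noncomputable def expSL (Y : R.hC) : Matrix.SpecialLinearGroup (Fin n) ℂ :=
  ⟨NormedSpace.exp (Y : Mat n), det_exp_eq_one (R.trace_eq_zero_of_mem_hC Y.2)⟩

lemma expSL_mem_HC (Y : R.hC) : R.expSL Y ∈ R.HC :=
  Subgroup.subset_closure (Or.inr ⟨Y, Y.2, rfl⟩)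

end RealForm

namespace HiggsBundle

variable {R : RealForm n} {P : PrincipalBundle.{u, v} X R.HC}

/-- The exponential `Ω⁰(P[𝔥ᶜ]) → Ω⁰(P[Hᶜ])` of the gauge group. -/
noncomputable def gaugeExp (s : P.Form R.hC 0 0) :
    P.ι → X → Matrix.SpecialLinearGroup (Fin n) ℂ :=
  fun i x => R.expSL ⟨s.1 i x, s.2.1 i x⟩

lemma coe_gaugeExp (s : P.Form R.hC 0 0) (i : P.ι) (x : X) :
    (gaugeExp s i x : Mat n) = NormedSpace.exp (s.1 i x) := rfl

/-- The gluing rule holds because `exp` commutes with conjugation by the transition functions;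
outside `U i` the convention `s = 0` becomes `exp s = 1`. -/
lemma gaugeExp_mem_gaugeGroup (s : P.Form R.hC 0 0) : gaugeExp s ∈ gaugeGroup P := by
  refine ⟨fun i x => R.expSL_mem_HC _, fun i x hx => ?_, fun i a b => ?_, fun i j x hi hj => ?_⟩
  · apply Subtype.ext
    change NormedSpace.exp (s.1 i x) = 1
    rw [s.2.2.1 i x hx, NormedSpace.exp_zero]
  · exact contDiffOn_exp_apply (s.2.2.2.1 i) a b
  · have h := s.2.2.2.2 i j x hi hj
    -- In bidegree `(0, 0)` the Jacobian factor is `1`.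
    simp only [pow_zero, mul_one, one_smul] at h
    have hg : (P.g i j x : Mat n) * ((P.g i j x)⁻¹ : Matrix.SpecialLinearGroup (Fin n) ℂ) = 1 := by
      rw [← Matrix.SpecialLinearGroup.coe_mul, mul_inv_cancel, Matrix.SpecialLinearGroup.coe_one]
    have hg' : ((P.g i j x)⁻¹ : Matrix.SpecialLinearGroup (Fin n) ℂ) * (P.g i j x : Mat n) = 1 := by
      rw [← Matrix.SpecialLinearGroup.coe_mul, inv_mul_cancel, Matrix.SpecialLinearGroup.coe_one]
    have h' : s.1 i x = (P.g i j x : Mat n) * s.1 j x *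
        ((P.g i j x)⁻¹ : Matrix.SpecialLinearGroup (Fin n) ℂ) := by
      rw [← h, mul_assoc, hg, mul_one]
    apply Subtype.ext
    change NormedSpace.exp (s.1 i x) = (P.g i j x * gaugeExp s j x * (P.g i j x)⁻¹ :
      Matrix.SpecialLinearGroup (Fin n) ℂ).1
    rw [h']
    change _ = ((P.g i j x * gaugeExp s j x * (P.g i j x)⁻¹ :
      Matrix.SpecialLinearGroup (Fin n) ℂ) : Mat n)
    rw [Matrix.SpecialLinearGroup.coe_mul, Matrix.SpecialLinearGroup.coe_mul]
    exact Matrix.exp_units_conj ⟨_, _, hg, hg'⟩ (s.1 j x)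

/-! ### Infinitesimal automorphisms -/

variable (E : HiggsBundle R P)

/-- The exponential of an infinitesimal automorphism is an automorphism. -/
lemma gaugeExp_mem_automorphisms {s : P.Form R.hC 0 0} (h0 : E.dbarH s = 0) (h1 : E.ad₀ s = 0) :
    gaugeExp s ∈ E.automorphisms := by
  refine ⟨gaugeExp_mem_gaugeGroup s, fun i x hx => ⟨?_, ?_⟩⟩
  · have hs : P.dbarMat i (s.1 i) x + (E.D.A i x * s.1 i x - s.1 i x * E.D.A i x) = 0 := by
      rw [← E.D.dbar_apply R.bracket_hC_hC 0 s hx]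
      exact congrFun (congrFun (congrArg Subtype.val h0) i) x
    have hz : (P.z i).symm (P.z i x) = x := (P.z i).left_inv hx
    -- Holomorphy of `s` reads `∂s/∂z̄ = [s, A]`, the hypothesis of `dbarAt_exp` with `B = A`.
    have hB : P.dbarMat i (s.1 i) x = s.1 i x * E.D.A i x - E.D.A i x * s.1 i x := by
      rw [eq_neg_of_add_eq_zero_left hs, neg_sub]
    have hexp : P.dbarMat i (fun y => (gaugeExp s i y : Mat n)) x =
        NormedSpace.exp (s.1 i x) * E.D.A i x - E.D.A i x * NormedSpace.exp (s.1 i x) := by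
      ext a b
      have := dbarAt_exp (s := fun w => s.1 i ((P.z i).symm w)) (z := P.z i x) (B := E.D.A i x)
        (fun a b => PrincipalBundle.form_differentiableAt s hx a b)
        (by rw [hz]; exact hB) a b
      rw [hz] at this
      exact this
    rw [hexp, coe_gaugeExp, sub_add_cancel]
  · have h : E.φ.1 i x * s.1 i x - s.1 i x * E.φ.1 i x = 0 :=
      congrFun (congrFun (congrArg Subtype.val h1) i) x
    exact Commute.exp_right (sub_eq_zero.1 h)

/-- A Higgs bundle with finitely many automorphisms has no infinitesimal automorphisms. -/
lemma eq_zero_of_finite_automorphisms (hE : E.automorphisms.Finite) {s : P.Form R.hC 0 0}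
    (h0 : E.dbarH s = 0) (h1 : E.ad₀ s = 0) : s = 0 := by
  ext i x : 3
  -- Evaluating the finitely many automorphisms at the fixed pair `(i, x)` leaves finitely many
  -- values for `exp (t s)` there.
  refine matrix_eq_zero_of_finite_range_exp
    ((hE.image fun u => (u i x : Mat n)).subset ?_)
  rintro _ ⟨t, rfl⟩
  exact ⟨gaugeExp (t • s), E.gaugeExp_mem_automorphisms (by rw [map_smul, h0, smul_zero])
    (by rw [map_smul, h1, smul_zero]), rfl⟩

lemma injective_adH0 (hE : E.automorphisms.Finite) : Function.Injective E.adH0 := by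
  rw [injective_iff_map_eq_zero]
  intro x hx
  exact Subtype.ext (E.eq_zero_of_finite_automorphisms hE x.2 (congrArg Subtype.val hx))

/-! ### Exactness at the inner terms -/

/-- The pair `(0, ψ)` is tangent to the gauge orbit exactly when `ψ = [φ, x]` with `∂̄_P x = 0`. -/
lemma exact_adH0_incl : Function.Exact E.adH0 E.incl := by
  intro ψ
  refine (Submodule.Quotient.mk_eq_zero E.TOrbit).trans ⟨?_, ?_⟩
  · rintro ⟨x, hx⟩
    have h : (E.dbarH x, E.ad₀ x) = ((0 : P.Form R.hC 0 1), ψ.1) := congrArg Subtype.val hx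
    exact ⟨⟨x, congrArg Prod.fst h⟩, Subtype.ext (congrArg Prod.snd h)⟩
  · rintro ⟨x, rfl⟩
    exact ⟨x.1, Subtype.ext (Prod.ext x.2 rfl)⟩

lemma exact_incl_proj : Function.Exact E.incl E.proj := by
  intro τ
  obtain ⟨⟨⟨α, ψ⟩, hτ⟩, rfl⟩ := Submodule.Quotient.mk_surjective E.TOrbit τ
  refine (Submodule.Quotient.mk_eq_zero (LinearMap.range E.dbarH)).trans ⟨?_, ?_⟩
  · rintro ⟨x, hx⟩
    change E.dbarH x = α at hx
    -- When `α = ∂̄_P x`, subtracting the gauge direction of `x` removes `α` and leaves `(0, ψ - [φ,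
    -- x])` in the same class.
    have hψ : E.dbarM (ψ - E.ad₀ x) = 0 := by
      have h : E.dbarM ψ + E.ad₁ α = 0 := hτ
      rw [map_sub, dbarM_ad₀, hx, sub_neg_eq_add, h]
    refine ⟨⟨ψ - E.ad₀ x, hψ⟩, (Submodule.Quotient.eq E.TOrbit).2 ⟨-x, Subtype.ext ?_⟩⟩
    refine Prod.ext ?_ ?_
    · change E.dbarH (-x) = 0 - α
      rw [map_neg, hx, zero_sub]
    · change E.ad₀ (-x) = ψ - E.ad₀ x - ψ
      rw [map_neg]
      abel
  · rintro ⟨χ, hχ⟩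
    obtain ⟨x, hx⟩ := (Submodule.Quotient.eq E.TOrbit).1 hχ
    have h : E.dbarH x = 0 - α := congrArg Prod.fst (congrArg Subtype.val hx)
    refine ⟨-x, ?_⟩
    rw [map_neg, h, zero_sub, neg_neg]
    rfl

lemma exact_proj_adH1 : Function.Exact E.proj E.adH1 := by
  intro a
  obtain ⟨α, rfl⟩ := Submodule.Quotient.mk_surjective _ a
  refine (Submodule.Quotient.mk_eq_zero (LinearMap.range E.dbarM)).trans ⟨?_, ?_⟩
  · rintro ⟨ψ, hψ⟩
    -- If `[α, φ] = ∂̄_P ψ`, the lift of `α` solving the linearized equation is `(α, -ψ)`.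
    have h : E.dbarM (-ψ) + E.ad₁ α = 0 := by rw [map_neg, hψ, neg_add_cancel]
    let τ : E.TH := ⟨(α, -ψ), h⟩
    exact ⟨Submodule.Quotient.mk τ, rfl⟩
  · rintro ⟨τ, hτ⟩
    obtain ⟨⟨⟨β, ψ⟩, h⟩, rfl⟩ := Submodule.Quotient.mk_surjective E.TOrbit τ
    replace h : E.dbarM ψ + E.ad₁ β = 0 := h
    obtain ⟨x, hx⟩ := (Submodule.Quotient.eq (LinearMap.range E.dbarH)).1 hτ
    replace hx : E.dbarH x = β - α := hx
    -- With `β = α + ∂̄_P x` and `∂̄_P ψ = -[β, φ]`, one gets `[α, φ] = [β, φ] - [∂̄_P x, φ] = ∂̄_P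
    -- ([φ, x] - ψ)`.
    refine ⟨E.ad₀ x - ψ, ?_⟩
    rw [map_sub, dbarM_ad₀, hx, map_sub, eq_neg_of_add_eq_zero_left h]
    abel

end HiggsBundle

end HiggsTangent

theorem mainTheorem8 {n : ℕ} (R : HiggsTangent.RealForm n)
    {X : Type*} [TopologicalSpace X] [T2Space X] [CompactSpace X] [ConnectedSpace X]
    [ChartedSpace ℂ X] [IsManifold 𝓘(ℂ, ℂ) ω X]
    (P : HiggsTangent.PrincipalBundle X R.HC) (E : HiggsTangent.HiggsBundle R P)
    (hE : E.IsStable) :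
    Function.Injective E.adH0 ∧
      Function.Exact E.adH0 E.incl ∧
      Function.Exact E.incl E.proj ∧
      Function.Exact E.proj E.adH1 := by
  exact ⟨E.injective_adH0 hE.2, E.exact_adH0_incl, E.exact_incl_proj, E.exact_proj_adH1⟩
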